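/- Let $k$ be an algebraically closed field of characteristic zero. A variety is an integral separated scheme of finite type over $k$ (thus irreducible), and $\mathrm{Bir}(X)$ denotes the group of birational self-maps over $k$ of a variety $X$. A (faithful) rational action of a finite group $G$ on $X$ is an injective homomorphism $\varrho\colon G\hookrightarrow \mathrm{Bir}(X)$. We say that $\varrho$ has a fixed point if there are a smooth complete irreducible variety $Y$ over $k$, a regular action $G\to\mathrm{Aut}(Y)$, a $G$-equivariant birational isomorphism $X\dashrightarrow Y$, and a $k$-point $y\in Y$ fixed by $G$. Given rational actions $\varrho_i\colon G\hookrightarrow\mathrm{Bir}(X_i)$, $i=1,2$, we say that $\varrho_1$ is obtained by a nontrivial base change from $\varrho_2$ if there is a $G$-equivariant dominant rational map $\varphi\colon X_1\dashrightarrow X_2$ over $k$ that is not a birational isomorphism (the base change is then along the induced map $X_1/\!\!/G\dashrightarrow X_2/\!\!/G$ of rational quotients). **Theorem.** Let $n\geqslant 1$, let $X$ be an $n$-dimensional irreducible variety over $k$, and let $\varrho\colon G\hookrightarrow\mathrm{Bir}(X)$ be a faithful rational action of a finite group $G$ on $X$ that has a fixed point. Then there is a faithful linear action $\tau\colon G\hookrightarrow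 \mathrm{GL}_n(k)$ of $G$ on the $n$-dimensional vector space $k^n$ such that $\varrho$ is obtained by a nontrivial base change from $\tau$. -/

import Mathlib

open CategoryTheory AlgebraicGeometry

universe u v

noncomputable section

namespace RatAct

/-- A dominant rational map `X ⤏ Y` over the base scheme `S`. -/
@[ext]
structure DomRatMap (S X Y : Scheme.{u}) [X.Over S] [Y.Over S] where
  toRationalMap : X ⤏ Y
  isDominant : toRationalMap.IsDominant
  isOver : toRationalMap.IsOver S

namespace DomRatMap

variable {S X Y Z W : Scheme.{u}} [X.Over S] [Y.Over S] [Z.Over S] [W.Over S]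
  [IsIntegral X] [IsIntegral Y] [IsIntegral Z] [IsIntegral W]

/-- The composite rational map: first `f`, then `g`. -/
def comp (f : DomRatMap S X Y) (g : DomRatMap S Y Z) : DomRatMap S X Z :=
  haveI := f.isDominant
  haveI := f.isOver
  haveI := g.isDominant
  haveI := g.isOver
  { toRationalMap := f.toRationalMap.comp g.toRationalMap
    isDominant := inferInstance
    isOver := inferInstance }

/-- A dominant morphism over `S`, regarded as a rational map. -/
def ofHom (f : X ⟶ Y) [IsDominant f] [f.IsOver S] : DomRatMap S X Y where
  toRationalMap := Scheme.Hom.toRationalMap f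
  isDominant := inferInstance
  isOver := inferInstance

variable (S X) in
/-- The identity rational map. -/
protected def id : DomRatMap S X X := ofHom (𝟙 X)

theorem comp_assoc (f : DomRatMap S X Y) (g : DomRatMap S Y Z) (h : DomRatMap S Z W) :
    (f.comp g).comp h = f.comp (g.comp h) := by
  have := f.isDominant
  have := g.isDominant
  exact DomRatMap.ext (Scheme.RationalMap.comp_assoc f.toRationalMap g.toRationalMap
    h.toRationalMap)

theorem id_comp (f : DomRatMap S X Y) : (DomRatMap.id S X).comp f = f :=
  DomRatMap.ext (Scheme.RationalMap.id_comp f.toRationalMap)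

theorem comp_id (f : DomRatMap S X Y) : f.comp (DomRatMap.id S Y) = f := by
  have := f.isDominant
  exact DomRatMap.ext (Scheme.RationalMap.comp_id f.toRationalMap)

theorem ofHom_comp_ofHom (f : X ⟶ Y) (g : Y ⟶ Z) [IsDominant f] [f.IsOver S] [IsDominant g]
    [g.IsOver S] [IsDominant (f ≫ g)] :
    (ofHom f : DomRatMap S X Y).comp (ofHom g) = ofHom (f ≫ g) := by
  refine DomRatMap.ext ?_
  change (Scheme.Hom.toRationalMap f).comp (Scheme.Hom.toRationalMap g) = _
  rw [Scheme.RationalMap.comp_toRationalMap]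
  rfl

/-- A dominant rational map over `S` is a birational isomorphism if it has an inverse
rational map over `S`. -/
def IsBirational (f : DomRatMap S X Y) : Prop :=
  ∃ g : DomRatMap S Y X, f.comp g = DomRatMap.id S X ∧ g.comp f = DomRatMap.id S Y

/-- Dominant rational self-maps form a monoid, where `f * g` is `f ∘ g` (first `g`, then `f`). -/
instance : Monoid (DomRatMap S X X) where
  mul f g := g.comp f
  one := DomRatMap.id S X
  mul_assoc f g h := (comp_assoc h g f).symm
  one_mul := comp_id
  mul_one := id_comp

end DomRatMap

/-- The group `Bir_S(X)` of birational self-maps of `X` over `S`; the product of `f` and `g` is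
`f ∘ g`. -/
abbrev Bir (S X : Scheme.{u}) [X.Over S] [IsIntegral X] : Type u := (DomRatMap S X X)ˣ

/-- The group `Aut_S(X)` of automorphisms of `X` over `S`; the product of `f` and `g` is
`f ∘ g`. -/
abbrev AutOver (S X : Scheme.{u}) [X.Over S] : Type u := Aut (X.asOver S)

/-- The morphism of schemes underlying an automorphism over `S`. -/
abbrev AutOver.toHom {S X : Scheme.{u}} [X.Over S] (f : AutOver S X) : X ⟶ X := f.hom.left

instance {S X : Scheme.{u}} [X.Over S] (f : AutOver S X) : IsIso f.toHom :=
  ((Over.forget S).mapIso f).isIso_hom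

instance {S X : Scheme.{u}} [X.Over S] (f : AutOver S X) : (f.toHom).IsOver S :=
  ⟨Over.w (Iso.hom f)⟩

/-- The natural homomorphism `Aut_S(X) → Bir_S(X)`. -/
def autToBir (S X : Scheme.{u}) [X.Over S] [IsIntegral X] : AutOver S X →* Bir S X :=
  MonoidHom.toHomUnits
    { toFun := fun f => DomRatMap.ofHom f.toHom
      map_one' := rfl
      map_mul' := fun f g => (DomRatMap.ofHom_comp_ofHom g.toHom f.toHom).symm }

section Actions

variable {S X Y : Scheme.{u}} [X.Over S] [Y.Over S] [IsIntegral X] [IsIntegral Y]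
  {G : Type v} [Group G]

/-- `φ : X ⤏ Y` is `G`-equivariant for actions of `G` on `X` and on `Y` by birational self-maps:
`φ ∘ ρ₁(g) = ρ₂(g) ∘ φ` for all `g`. -/
def IsEquivariant (ρ₁ : G →* Bir S X) (ρ₂ : G →* Bir S Y) (φ : DomRatMap S X Y) : Prop :=
  ∀ g : G, (ρ₁ g : DomRatMap S X X).comp φ = φ.comp (ρ₂ g : DomRatMap S Y Y)

/-- `ρ₁` is obtained by a nontrivial base change from `ρ₂` : there is a `G`-equivariant dominant
rational map `φ : X ⤏ Y` (a compression of `ρ₁` into `ρ₂`) that is not a birational isomorphism.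
The base change in question is along the map `X // G ⤏ Y // G` of rational quotients which
`φ` induces. -/
def IsNontrivialBaseChange (ρ₁ : G →* Bir S X) (ρ₂ : G →* Bir S Y) : Prop :=
  ∃ φ : DomRatMap S X Y, IsEquivariant ρ₁ ρ₂ φ ∧ ¬ φ.IsBirational

/-- The regular action `σ` of `G` on the irreducible variety `Y` is a regularization of the
rational action `ρ` of `G` on `X` : `Y` is smooth and complete, and there is a `G`-equivariant
birational isomorphism `X ⤏ Y`. -/
def IsRegularization (ρ : G →* Bir S X) (σ : G →* AutOver S Y) : Prop :=
  Smooth (Y ↘ S) ∧ IsProper (Y ↘ S) ∧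
    ∃ α : DomRatMap S X Y, α.IsBirational ∧ IsEquivariant ρ ((autToBir S Y).comp σ) α

end Actions

/-- The rational action `ρ` on `X` has a fixed point: some regularization of `ρ`, on a smooth
complete irreducible variety `Y`, has a fixed `k`-point `y`. -/
def HasFixedPoint {k : Type u} [Field k] {X : Scheme.{u}} [X.Over (Spec (.of k))] [IsIntegral X]
    {G : Type v} [Group G] (ρ : G →* Bir (Spec (.of k)) X) : Prop :=
  ∃ (Y : Scheme.{u}) (_ : Y.Over (Spec (.of k))) (_ : IsIntegral Y)
    (σ : G →* AutOver (Spec (.of k)) Y), IsRegularization ρ σ ∧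
      ∃ y : Spec (.of k) ⟶ Y, y ≫ (Y ↘ Spec (.of k)) = 𝟙 _ ∧ ∀ g : G, y ≫ (σ g).toHom = y

section LinearActions

variable (k : Type u) [Field k] (n : ℕ)

/-- The vector space `kⁿ` as a variety: `Spec k[x₁, …, xₙ]`. -/
def linSpace : Scheme.{u} := Spec (.of (MvPolynomial (Fin n) k))

instance : (linSpace k n).Over (Spec (.of k)) :=
  ⟨Spec.map (CommRingCat.ofHom MvPolynomial.C)⟩

instance : IsIntegral (linSpace k n) :=
  inferInstanceAs (IsIntegral (Spec (.of (MvPolynomial (Fin n) k))))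

/-- The pullback of polynomial functions along the linear map `a ↦ A a`:
`xᵢ ↦ ∑ⱼ Aᵢⱼ xⱼ`. -/
def linPullback (A : Matrix (Fin n) (Fin n) k) :
    MvPolynomial (Fin n) k →ₐ[k] MvPolynomial (Fin n) k :=
  MvPolynomial.aeval fun i => ∑ j, MvPolynomial.C (A i j) * MvPolynomial.X j

/-- The endomorphism `a ↦ A a` of the variety `kⁿ`. -/
def linEnd : Matrix (Fin n) (Fin n) k →* End ((linSpace k n).asOver (Spec (.of k))) where
  toFun A := Over.homMk (Spec.map (CommRingCat.ofHom (linPullback k n A).toRingHom)) (by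
    change Spec.map _ ≫ Spec.map _ = Spec.map _
    rw [← Spec.map_comp, ← CommRingCat.ofHom_comp]
    congr 2
    exact (linPullback k n A).comp_algebraMap)
  map_one' := by
    refine Over.OverMorphism.ext ?_
    change Spec.map _ = 𝟙 (Spec _)
    rw [← Spec.map_id, ← CommRingCat.ofHom_id]
    congr 2
    have : linPullback k n 1 = AlgHom.id k _ := by
      ext i : 1
      simp [linPullback, Matrix.one_apply]
    rw [this]
    rfl
  map_mul' A B := by
    refine Over.OverMorphism.ext ?_
    change Spec.map _ = Spec.map _ ≫ Spec.map _
    rw [← Spec.map_comp, ← CommRingCat.ofHom_comp]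
    congr 2
    have : linPullback k n (A * B) = (linPullback k n B).comp (linPullback k n A) := by
      ext i : 1
      simp [linPullback, Matrix.mul_apply, Finset.sum_mul, Finset.mul_sum, mul_assoc]
      rw [Finset.sum_comm]
    rw [this]
    rfl

/-- The natural homomorphism `GLₙ(k) → Aut_k(kⁿ) → Bir_k(kⁿ)`. -/
def glToBir : GL (Fin n) k →* Bir (Spec (.of k)) (linSpace k n) :=
  (autToBir _ _).comp ((Aut.unitsEndEquivAut _).toMonoidHom.comp (Units.map (linEnd k n)))

end LinearActions

end RatAct

end

/-! Let `O` be the local ring at the fixed point of a regularization `Y`. The group acts on `O`,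
with residue field `k`, and preserves the maximal ideal `m` and `m²`. In characteristic zero
Maschke's theorem gives a `G`-stable `k`-subspace `W` of `m` complementary to `m²`
(`exists_equivariant_projection`).

Smoothness forces `dim W = n`: it embeds `m/m²` in the fibre of `Ω[O⁄k]`, which is free of rank at
most `n`; conversely `dW` generates the differentials, so the function field is algebraic over
`k(W)`. A basis of `W` is thus algebraically independent and defines a dominant equivariant rational
map from `Y` to `kⁿ` with a linear action (`exists_equivariant_coordinates`,
`exists_equivariant_of_fixed_point`). An element acting trivially on `W` acts trivially on `O` by
Krull's intersection theorem, hence on `Y`, so the linear action is faithful.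

If the resulting compression is already birational, it is composed with `v ↦ q(v) v`, where `q` is a
nonzero invariant form of degree `|G|`. This self-map is equivariant and dominant but not
birational, since it is unchanged under scaling by roots of unity of order `|G| + 1`
(`exists_isEquivariant_not_isBirational`). -/

noncomputable section

namespace RatAct

/-! ### Krull dimension and transcendence degree of finitely generated domains -/

section KrullDimension

/-- Incomparability gives one inequality; lying over and going up lift chains for the other. -/
theorem ringKrullDim_eq_of_isIntegral {R S : Type*} [CommRing R] [CommRing S] [Algebra R S]
    [Algebra.IsIntegral R S] [FaithfulSMul R S] : ringKrullDim S = ringKrullDim R := by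
  refine le_antisymm (Order.krullDim_le_of_strictMono (PrimeSpectrum.comap (algebraMap R S))
    fun p q h ↦ Ideal.IsIntegral.comap_lt_comap h) (iSup_le fun l ↦ ?_)
  obtain ⟨P, hP⟩ := Ideal.nonempty_primesOver (R := R) (S := S) (RelSeries.head l).asIdeal
  have := hP.1
  have := hP.2
  obtain ⟨L, hL, -⟩ := Ideal.exists_ltSeries_of_hasGoingUp l P
  rw [← hL]
  exact le_iSup (fun p : LTSeries (PrimeSpectrum S) ↦ (p.length : WithBot ℕ∞)) L

/-- By Noether normalization, both invariants equal the number of variables of a polynomial subring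
over which `A` is integral. -/
theorem ringKrullDim_eq_trdeg (k A K : Type u) [Field k] [CommRing A] [IsDomain A] [Algebra k A]
    [Algebra.FiniteType k A] [Field K] [Algebra A K] [IsFractionRing A K] [Algebra k K]
    [IsScalarTower k A K] :
    ∃ d : ℕ, ringKrullDim A = d ∧ Algebra.trdeg k K = d := by
  obtain ⟨s, g, hg, hint⟩ := exists_integral_inj_algHom_of_fg k A
  refine ⟨s, ?_, ?_⟩
  · algebraize [g.toRingHom]
    have : FaithfulSMul (MvPolynomial (Fin s) k) A :=
      (faithfulSMul_iff_algebraMap_injective _ _).mpr hg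
    have : Algebra.IsIntegral (MvPolynomial (Fin s) k) A := ⟨hint⟩
    rw [ringKrullDim_eq_of_isIntegral (R := MvPolynomial (Fin s) k),
      MvPolynomial.ringKrullDim_of_isNoetherianRing, ringKrullDim_eq_zero_of_field]
    simp
  · algebraize [g.toRingHom]
    have : FaithfulSMul (MvPolynomial (Fin s) k) A :=
      (faithfulSMul_iff_algebraMap_injective _ _).mpr hg
    have : Algebra.IsIntegral (MvPolynomial (Fin s) k) A := ⟨hint⟩
    have : FaithfulSMul k A := inferInstance
    have h1 := trdeg_add_eq k (MvPolynomial (Fin s) k) (A := A)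
    have h2 := trdeg_add_eq k A (A := K)
    have : Algebra.IsAlgebraic A K := IsLocalization.isAlgebraic K (nonZeroDivisors A)
    rw [← h2, ← h1, trdeg_eq_zero (R := A), trdeg_eq_zero (R := MvPolynomial (Fin s) k),
      MvPolynomial.trdeg_of_isDomain]
    simp

end KrullDimension

/-! ### Dimension of a variety and transcendence degree of its function field -/

section Stalks

variable {k : Type u} [Field k] (X : Scheme.{u}) [X.Over (Spec (.of k))]

/-- The structure map from the base field to a stalk. -/
def baseToStalk (x : X) : CommRingCat.of k ⟶ X.presheaf.stalk x :=
  Spec.preimage (X.fromSpecStalk x ≫ (X ↘ Spec (.of k)))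

theorem Spec_map_baseToStalk (x : X) :
    Spec.map (baseToStalk (k := k) X x) = X.fromSpecStalk x ≫ (X ↘ Spec (.of k)) :=
  Spec.map_preimage _

theorem topologicalKrullDim_eq_iSup_stalk :
    topologicalKrullDim X = ⨆ x : X, ringKrullDim (X.presheaf.stalk x) := by
  let : PartialOrder X := specializationOrder X
  have e : TopologicalSpace.IrreducibleCloseds X ≃o X := irreducibleSetEquivPoints
  rw [topologicalKrullDim, Order.krullDim_eq_of_orderIso e, Order.krullDim_eq_iSup_coheight]
  exact iSup_congr fun x ↦ (ringKrullDim_stalk_eq_coheight x).symm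

/-- All nonempty affine opens share one fraction field, hence one dimension `d`. Each stalk
localizes the coordinate ring of such an open, which bounds the dimension above; a single affine
open bounds it below. -/
theorem topologicalKrullDim_eq_trdeg [IsIntegral X] [LocallyOfFiniteType (X ↘ Spec (.of k))] :
    letI : Algebra k X.functionField := (baseToStalk X (genericPoint X)).hom.toAlgebra
    ∃ d : ℕ, topologicalKrullDim X = d ∧ Algebra.trdeg k X.functionField = d := by
  let : Algebra k X.functionField := (baseToStalk X (genericPoint X)).hom.toAlgebra
  have key (U : X.Opens) (hU : IsAffineOpen U) [Nonempty U] :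
      ∃ d : ℕ, ringKrullDim Γ(X, U) = d ∧ Algebra.trdeg k X.functionField = d := by
    let φ : CommRingCat.of k ⟶ Γ(X, U) := Spec.preimage (hU.fromSpec ≫ (X ↘ Spec (.of k)))
    let : Algebra k Γ(X, U) := φ.hom.toAlgebra
    have hφ : Spec.map φ = hU.fromSpec ≫ (X ↘ Spec (.of k)) := Spec.map_preimage _
    have h1 : LocallyOfFiniteType (Spec.map φ) := by rw [hφ]; infer_instance
    have : Algebra.FiniteType k Γ(X, U) :=
      (HasRingHomProperty.Spec_iff (P := @LocallyOfFiniteType)).mp h1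
    have := functionField_isFractionRing_of_isAffineOpen X U hU
    have : IsScalarTower k Γ(X, U) X.functionField := by
      refine IsScalarTower.of_algebraMap_eq' ?_
      have : baseToStalk X (genericPoint X) = φ ≫ X.germToFunctionField U := by
        apply Spec.map_injective
        rw [Spec_map_baseToStalk, Spec.map_comp, hφ, ← Category.assoc]
        congr 1
        rw [← hU.fromSpecStalk_eq_fromSpecStalk]
        rfl
      exact congr($(this).hom)
    exact ringKrullDim_eq_trdeg k Γ(X, U) X.functionField
  obtain ⟨_, ⟨U, hU, rfl⟩, hxU, -⟩ := X.isBasis_affineOpens.exists_subset_of_mem_open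
    (Set.mem_univ (genericPoint X)) isOpen_univ
  have : Nonempty U := ⟨⟨_, hxU⟩⟩
  obtain ⟨d, hd, hd'⟩ := key U hU
  refine ⟨d, le_antisymm ?_ ?_, hd'⟩
  · rw [topologicalKrullDim_eq_iSup_stalk]
    refine iSup_le fun x ↦ ?_
    obtain ⟨_, ⟨V, hV, rfl⟩, hxV, -⟩ := X.isBasis_affineOpens.exists_subset_of_mem_open
      (Set.mem_univ x) isOpen_univ
    have : Nonempty V := ⟨⟨_, hxV⟩⟩
    obtain ⟨e, he, he'⟩ := key V hV
    have hde : d = e := by exact_mod_cast hd'.symm.trans he'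
    let := TopCat.Presheaf.algebra_section_stalk X.presheaf (⟨x, hxV⟩ : V)
    have := hV.isLocalization_stalk ⟨x, hxV⟩
    rw [hde, ← he, IsLocalization.AtPrime.ringKrullDim_eq_height
      (hV.primeIdealOf ⟨x, hxV⟩).asIdeal (X.presheaf.stalk x)]
    exact Ideal.height_le_ringKrullDim_of_isPrime
  · have h := topologicalKrullDim_subspace_le X U
    rw [← hd, ← PrimeSpectrum.topologicalKrullDim_eq_ringKrullDim]
    exact (IsHomeomorph.topologicalKrullDim_eq _
      hU.isoSpec.hom.homeomorph.isHomeomorph).symm.le.trans h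

end Stalks

/-! ### Differentials and algebraic dependence in characteristic zero -/

section Differentials

open KaehlerDifferential

variable {k K : Type u} [Field k] [Field K] [Algebra k K]

/-- The elements of `K` whose differential lies in a given subspace of `Ω[K⁄k]`. -/
def fieldOfDifferentials (N : Submodule K (Ω[K⁄k])) : IntermediateField k K where
  carrier := {x | D k K x ∈ N}
  mul_mem' {x y} hx hy := by
    simp only [Set.mem_ofPred_eq, Derivation.leibniz] at *
    exact N.add_mem (N.smul_mem _ hy) (N.smul_mem _ hx)
  add_mem' {x y} hx hy := by
    simp only [Set.mem_ofPred_eq, map_add] at *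
    exact N.add_mem hx hy
  algebraMap_mem' c := by simp
  inv_mem' x hx := by
    simp only [Set.mem_ofPred_eq, Derivation.leibniz_inv] at *
    exact N.smul_mem _ hx

theorem mem_fieldOfDifferentials {N : Submodule K (Ω[K⁄k])} {x : K} :
    x ∈ fieldOfDifferentials N ↔ D k K x ∈ N := Iff.rfl

/-- Over `F = k(b)` all the `d(bᵢ)` vanish, so `Ω[K⁄F] = 0`; an unramified, essentially finite field
extension is separable algebraic. -/
theorem isAlgebraic_adjoin_of_span_D_eq_top [CharZero k] [Algebra.EssFiniteType k K]
    {ι : Type*} (b : ι → K) (hb : Submodule.span K (Set.range fun i ↦ D k K (b i)) = ⊤) :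
    Algebra.IsAlgebraic (Algebra.adjoin k (Set.range b)) K := by
  let F := IntermediateField.adjoin k (Set.range b)
  have : Algebra.EssFiniteType F K := Algebra.EssFiniteType.of_comp k F K
  have hsub : Subsingleton (Ω[K⁄F]) := by
    refine Submodule.subsingleton_iff K |>.mp (subsingleton_of_bot_eq_top ?_)
    have h : LinearMap.range (map k F K K) = ⊤ :=
      LinearMap.range_eq_top.mpr (map_surjective k F K)
    rw [← h, LinearMap.range_eq_map, ← hb, Submodule.map_span, eq_comm, Submodule.span_eq_bot]
    rintro _ ⟨_, ⟨i, rfl⟩, rfl⟩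
    rw [map_D]
    exact (D F K).map_algebraMap
      (⟨b i, IntermediateField.subset_adjoin _ _ ⟨i, rfl⟩⟩ : F)
  have : Algebra.FormallyUnramified F K := ⟨hsub⟩
  have := Algebra.FormallyUnramified.isSeparable F K
  have : Algebra.IsAlgebraic F K := inferInstance
  open scoped IntermediateField.algebraAdjoinAdjoin in
  exact (IsFractionRing.comap_isAlgebraic_iff (K := F)).mpr this

/-- The extension `K/k(b)` is separable, so `Ω[K⁄k]` is generated by differentials of elements of
`k(b)`. Elements whose differential lies in the span form a field containing `b`, hence all of
`k(b)`. -/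
theorem span_D_eq_top_of_isAlgebraic_adjoin [CharZero k]
    {ι : Type*} (b : ι → K) [Algebra.IsAlgebraic (Algebra.adjoin k (Set.range b)) K] :
    Submodule.span K (Set.range fun i ↦ D k K (b i)) = ⊤ := by
  let F := IntermediateField.adjoin k (Set.range b)
  have : Algebra.IsAlgebraic F K := by
    open scoped IntermediateField.algebraAdjoinAdjoin in
    exact (IsFractionRing.comap_isAlgebraic_iff
      (A := Algebra.adjoin k (Set.range b)) (K := F)).mp inferInstance
  have hF := Algebra.FormallyUnramified.of_isSeparable F K
  have hF' : Subsingleton (Ω[K⁄F]) := hF.1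
  have hle : F ≤ fieldOfDifferentials (Submodule.span K (Set.range fun i ↦ D k K (b i))) := by
    refine IntermediateField.adjoin_le_iff.mpr ?_
    rintro _ ⟨i, rfl⟩
    exact Submodule.subset_span ⟨i, rfl⟩
  have hr : LinearMap.range (mapBaseChange k F K) = ⊤ := by
    rw [range_mapBaseChange, eq_top_iff]
    exact fun x _ ↦ Subsingleton.elim _ _
  rw [eq_top_iff, ← hr]
  rintro _ ⟨x, rfl⟩
  induction x with
  | zero => simp
  | add x y hx hy => rw [map_add]; exact add_mem hx hy
  | tmul c w =>
    rw [mapBaseChange_tmul]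
    refine Submodule.smul_mem _ _ ?_
    have hw : w ∈ Submodule.span F (Set.range (D k F)) := by
      rw [span_range_derivation]; trivial
    induction hw using Submodule.span_induction with
    | mem x hx =>
      obtain ⟨x, rfl⟩ := hx
      rw [map_D]
      exact hle x.2
    | zero => simp
    | add x y _ _ hx hy => rw [map_add]; exact add_mem hx hy
    | smul a x _ hx =>
      rw [map_smul]
      exact Submodule.smul_of_tower_mem _ a hx

theorem finrank_kaehlerDifferential_le [CharZero k] {n : ℕ} (h : Algebra.trdeg k K = n) :
    Module.finrank K (Ω[K⁄k]) ≤ n := by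
  obtain ⟨s, hs⟩ := exists_isTranscendenceBasis k K
  have hc : Cardinal.mk s = n := hs.cardinalMk_eq_trdeg.trans h
  have : Finite s := Cardinal.mk_lt_aleph0_iff.mp (hc ▸ Cardinal.natCast_lt_aleph0)
  have := Fintype.ofFinite s
  have := hs.isAlgebraic
  have := finrank_le_of_span_eq_top (span_D_eq_top_of_isAlgebraic_adjoin (k := k) ((↑) : s → K))
  rwa [← Nat.card_eq_fintype_card, Nat.card, hc, Cardinal.toNat_natCast] at this

theorem span_D_eq_top_of_isFractionRing {O : Type u} [CommRing O] [IsDomain O] [Algebra k O]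
    [Algebra O K] [IsFractionRing O K] [IsScalarTower k O K] {ι : Type*} (f : ι → O)
    (hf : Submodule.span O (Set.range fun i ↦ D k O (f i)) = ⊤) :
    Submodule.span K (Set.range fun i ↦ D k K (algebraMap O K (f i))) = ⊤ := by
  set N := Submodule.span K (Set.range fun i ↦ D k K (algebraMap O K (f i))) with hN
  have key (x : O) : algebraMap O K x ∈ fieldOfDifferentials N := by
    rw [mem_fieldOfDifferentials, ← map_D k k O K]
    have hx : D k O x ∈ Submodule.span O (Set.range fun i ↦ D k O (f i)) := by
      rw [hf]; trivial
    have := Submodule.mem_map_of_mem (f := map k k O K) hx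
    rw [Submodule.map_span] at this
    refine (Submodule.span_le_restrictScalars O K _) (Submodule.span_mono ?_ this)
    rintro _ ⟨_, ⟨i, rfl⟩, rfl⟩
    exact ⟨i, (map_D k k O K _).symm⟩
  rw [eq_top_iff, ← span_range_derivation, Submodule.span_le]
  rintro _ ⟨x, rfl⟩
  obtain ⟨y, z, -, rfl⟩ := IsFractionRing.div_surjective (A := O) x
  exact mem_fieldOfDifferentials.mp (div_mem (key y) (key z))

theorem finrank_kaehlerDifferential_eq_of_isFractionRing {O : Type u} [CommRing O] [IsDomain O]
    [Algebra k O] [Algebra O K] [IsFractionRing O K] [IsScalarTower k O K]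
    [Module.Free O (Ω[O⁄k])] :
    Module.finrank K (Ω[K⁄k]) = Module.finrank O (Ω[O⁄k]) := by
  have : Algebra.FormallyEtale O K := .of_isLocalization (nonZeroDivisors O)
  exact (tensorKaehlerEquivOfFormallyEtale k O K).symm.finrank_eq.trans Module.finrank_baseChange

end Differentials

/-! ### Maschke's theorem -/

section Averaging

variable {k : Type*} [Field k] [CharZero k] {V : Type*} [AddCommGroup V] [Module k V]
  {G : Type*} [Group G] [Finite G]

/-- Maschke's theorem for a right action: a stable subspace is the kernel of an equivariant
projection. -/
theorem exists_equivariant_projection (a : G → V →ₗ[k] V) (h1 : a 1 = LinearMap.id)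
    (hmul : ∀ g h, a (g * h) = a h ∘ₗ a g) (N : Submodule k V) (hN : ∀ g, ∀ x ∈ N, a g x ∈ N) :
    ∃ p : V →ₗ[k] V, (∀ x ∈ N, p x = 0) ∧ (∀ x, p x - x ∈ N) ∧ ∀ g x, a g (p x) = p (a g x) := by
  have := Fintype.ofFinite G
  obtain ⟨s, hs⟩ := N.mkQ.exists_rightInverse_of_surjective N.range_mkQ
  have hs' (x : V) : s (N.mkQ x) - x ∈ N := by
    rw [← Submodule.Quotient.eq]
    exact congr($hs (N.mkQ x))
  have hcard : (Fintype.card G : k) ≠ 0 := Nat.cast_ne_zero.mpr Fintype.card_ne_zero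
  -- The average of the conjugates of a linear projection `s ∘ N.mkQ` with kernel `N`. Since `a`
  -- reverses products, `a h ∘ a h⁻¹` is still the identity.
  let p : V →ₗ[k] V := (Fintype.card G : k)⁻¹ • ∑ h, a h ∘ₗ s ∘ₗ N.mkQ ∘ₗ a h⁻¹
  have hp (x : V) : p x = (Fintype.card G : k)⁻¹ • ∑ h, a h (s (N.mkQ (a h⁻¹ x))) := by
    simp [p]
  refine ⟨p, fun x hx ↦ ?_, fun x ↦ ?_, fun g x ↦ ?_⟩
  · rw [hp, Finset.sum_eq_zero, smul_zero]
    intro h _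
    have : N.mkQ (a h⁻¹ x) = 0 := by simpa using hN _ _ hx
    rw [this, map_zero, map_zero]
  · have hx : x = (Fintype.card G : k)⁻¹ • ∑ h : G, a h (a h⁻¹ x) := by
      have (h : G) : a h (a h⁻¹ x) = x := by
        rw [← LinearMap.comp_apply, ← hmul, inv_mul_cancel, h1, LinearMap.id_apply]
      simp only [this, Finset.sum_const, Finset.card_univ, ← Nat.cast_smul_eq_nsmul k, smul_smul]
      rw [inv_mul_cancel₀ hcard, one_smul]
    nth_rewrite 2 [hx]
    rw [hp, ← smul_sub, ← Finset.sum_sub_distrib]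
    refine N.smul_mem _ (N.sum_mem fun h _ ↦ ?_)
    rw [← map_sub]
    exact hN _ _ (hs' _)
  · rw [hp, hp, map_smul, map_sum]
    congr 1
    refine Fintype.sum_equiv (Equiv.mulRight g) _ _ fun h ↦ ?_
    rw [Equiv.coe_mulRight, hmul, LinearMap.comp_apply, mul_inv_rev,
      ← LinearMap.comp_apply (a (g⁻¹ * h⁻¹)), ← hmul, mul_inv_cancel_left]

end Averaging

/-! ### Equivariant coordinates at a smooth fixed point -/

section LocalCoordinates

open IsLocalRing KaehlerDifferential TensorProduct

variable {k O : Type u} [Field k] [CommRing O] [IsLocalRing O] [Algebra k O]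

/-- The square of the maximal ideal as a `k`-subspace. -/
abbrev maximalIdealSq (k O : Type u) [Field k] [CommRing O] [IsLocalRing O] [Algebra k O] :
    Submodule k O := ((maximalIdeal O) ^ 2).restrictScalars k

variable (hres : ∀ x : O, ∃ c : k, x - algebraMap k O c ∈ maximalIdeal O)
  (p : O →ₗ[k] O) (hp : ∀ x ∈ maximalIdealSq k O, p x = 0)
  (hp' : ∀ x, p x - x ∈ maximalIdealSq k O)

include hres hp in
-- Modulo `m²`, coefficients of elements of `m` matter only through their residues in `k`, so the
-- images under `p` of ideal generators of `m` span over `k`.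
theorem finite_map_maximalIdeal [IsNoetherianRing O] :
    Module.Finite k (((maximalIdeal O).restrictScalars k).map p) := by
  obtain ⟨s, hs⟩ := IsNoetherian.noetherian (maximalIdeal O)
  have key : ((maximalIdeal O).restrictScalars k).map p ≤ Submodule.span k (p '' s) := by
    rintro _ ⟨x, hx, rfl⟩
    replace hx : x ∈ Submodule.span O (s : Set O) := hs ▸ hx
    induction hx using Submodule.span_induction with
    | mem x hx => exact Submodule.subset_span ⟨x, hx, rfl⟩
    | zero => simp
    | add x y _ _ hx hy => rw [map_add]; exact add_mem hx hy
    | smul r x hx' hx =>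
      obtain ⟨c, hc⟩ := hres r
      have hx'' : x ∈ maximalIdeal O := hs ▸ hx'
      have h : p ((r - algebraMap k O c) * x) = 0 :=
        hp _ (by rw [Submodule.restrictScalars_mem, pow_two]; exact Ideal.mul_mem_mul hc hx'')
      have : r • x = c • x + (r - algebraMap k O c) * x := by
        rw [Algebra.smul_def c, smul_eq_mul]; ring
      rw [this, map_add, h, add_zero, map_smul]
      exact Submodule.smul_mem _ _ hx
  have := Module.Finite.span_of_finite k (s.finite_toSet.image p)
  exact Submodule.finiteDimensional_of_le key

theorem maximalIdealSq_le {x : O} (hx : x ∈ maximalIdealSq k O) : x ∈ maximalIdeal O :=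
  Ideal.pow_le_self two_ne_zero hx

include hp' in
theorem map_maximalIdeal_le {x : O} (hx : x ∈ ((maximalIdeal O).restrictScalars k).map p) :
    x ∈ maximalIdeal O := by
  obtain ⟨y, hy, rfl⟩ := hx
  have := add_mem (maximalIdealSq_le (hp' y)) hy
  rwa [sub_add_cancel] at this

include hp' in
-- Nakayama: each `x` in `m` differs from `p x` by an element of `m²`.
theorem span_eq_maximalIdeal [IsNoetherianRing O] {ι : Type*} (f : ι → O)
    (hf : ((maximalIdeal O).restrictScalars k).map p = Submodule.span k (Set.range f)) :
    Submodule.span O (Set.range f) = maximalIdeal O := by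
  have hle : Submodule.span O (Set.range f) ≤ maximalIdeal O := by
    refine Submodule.span_le.mpr ?_
    rintro _ ⟨i, rfl⟩
    exact map_maximalIdeal_le p hp' (hf ▸ Submodule.subset_span ⟨i, rfl⟩)
  refine le_antisymm hle (Submodule.le_of_le_smul_of_le_jacobson_bot (I := maximalIdeal O)
    (IsNoetherian.noetherian _) (IsLocalRing.maximalIdeal_le_jacobson _) fun x hx ↦ ?_)
  have h1 : p x ∈ Submodule.span O (Set.range f) := by
    refine Submodule.span_le_restrictScalars k O _ ?_
    rw [← hf]
    exact Submodule.mem_map_of_mem hx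
  have h2 : x - p x ∈ maximalIdeal O • maximalIdeal O := by
    rw [smul_eq_mul, ← pow_two, ← neg_sub]
    exact neg_mem (hp' x)
  rw [← add_sub_cancel (p x) x]
  exact Submodule.add_mem_sup h1 h2

include hres in
-- Constants have zero differential, so `d(m)` generates `Ω[O⁄k]`. For `x` in `m`, `d(r x) ≡ r dx`
-- modulo `m Ω[O⁄k]`, and Nakayama applies.
theorem span_D_eq_top [Algebra.EssFiniteType k O] {ι : Type*} (f : ι → O)
    (hf : Submodule.span O (Set.range f) = maximalIdeal O) :
    Submodule.span O (Set.range fun i ↦ D k O (f i)) = ⊤ := by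
  set N := Submodule.span O (Set.range fun i ↦ D k O (f i))
  refine eq_top_iff.mpr (Submodule.le_of_le_smul_of_le_jacobson_bot (I := maximalIdeal O)
    Module.Finite.fg_top (IsLocalRing.maximalIdeal_le_jacobson _) ?_)
  have key (x : O) (hx : x ∈ Submodule.span O (Set.range f)) :
      D k O x ∈ N ⊔ maximalIdeal O • (⊤ : Submodule O (Ω[O⁄k])) := by
    induction hx using Submodule.span_induction with
    | mem x hx =>
      obtain ⟨i, rfl⟩ := hx
      exact Submodule.mem_sup_left (Submodule.subset_span ⟨i, rfl⟩)
    | zero => simp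
    | add x y _ _ hx hy => rw [map_add]; exact add_mem hx hy
    | smul r x hx' hx =>
      rw [smul_eq_mul, Derivation.leibniz]
      exact add_mem (Submodule.smul_mem _ _ hx)
        (Submodule.mem_sup_right (Submodule.smul_mem_smul (hf ▸ hx') trivial))
  rw [← span_range_derivation, Submodule.span_le, span_range_derivation]
  rintro _ ⟨x, rfl⟩
  obtain ⟨c, hc⟩ := hres x
  have := key _ (hf ▸ hc)
  rwa [map_sub, Derivation.map_algebraMap, sub_zero] at this

include hres hp hp' in
-- Formal smoothness makes `m/m² → κ ⊗ Ω[O⁄k]` injective, and `p(m)` meets `m²` only in zero, so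
-- independent elements of `p(m)` have independent differentials at the closed point.
theorem card_le_finrank_kaehlerDifferential [Algebra.EssFiniteType k O]
    [Algebra.FormallySmooth k O] [Module.Free O (Ω[O⁄k])] {ι : Type*} [Fintype ι] (f : ι → O)
    (hf : LinearIndependent k f)
    (hmem : ∀ i, f i ∈ ((maximalIdeal O).restrictScalars k).map p) :
    Fintype.card ι ≤ Module.finrank O (Ω[O⁄k]) := by
  let κ := ResidueField O
  have hsurj : Function.Surjective (algebraMap k κ) := by
    intro y
    obtain ⟨x, rfl⟩ := residue_surjective y
    obtain ⟨c, hc⟩ := hres x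
    refine ⟨c, ?_⟩
    rw [← residue_eq_zero_iff, map_sub, sub_eq_zero] at hc
    exact hc.symm
  have hbij : Function.Bijective (algebraMap k κ) := ⟨(algebraMap k κ).injective, hsurj⟩
  have : Algebra.FormallyEtale k κ :=
    Algebra.FormallyEtale.of_equiv (AlgEquiv.ofBijective (Algebra.ofId k κ) hbij)
  have hinj : Function.Injective (kerCotangentToTensor k O κ) :=
    (Algebra.FormallySmooth.kerCotangentToTensor_injective_iff residue_surjective).mpr inferInstance
  have hli : LinearIndependent κ fun i ↦ ((1 : κ) ⊗ₜ[O] D k O (f i) : κ ⊗[O] Ω[O⁄k]) := by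
    rw [Fintype.linearIndependent_iff]
    intro g hg
    choose c hc using fun i ↦ hsurj (g i)
    set w := ∑ i, c i • f i with hw
    have hwW : w ∈ ((maximalIdeal O).restrictScalars k).map p :=
      Submodule.sum_mem _ fun i _ ↦ Submodule.smul_mem _ _ (hmem i)
    have hwm : w ∈ RingHom.ker (algebraMap O κ) := by
      rw [RingHom.mem_ker]
      exact (residue_eq_zero_iff _).mpr (map_maximalIdeal_le p hp' hwW)
    have h0 : kerCotangentToTensor k O κ (Ideal.toCotangent _ ⟨w, hwm⟩) = 0 := by
      rw [kerCotangentToTensor_toCotangent, ← hg]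
      change _ ⊗ₜ[O] D k O w = _
      rw [hw, map_sum, tmul_sum]
      refine Finset.sum_congr rfl fun i _ ↦ ?_
      rw [← hc, algebraMap_smul, Derivation.map_smul, tmul_smul]
    have h1 : w ∈ RingHom.ker (algebraMap O κ) ^ 2 :=
      (Ideal.toCotangent_eq_zero _ _).mp (hinj (h0.trans (map_zero _).symm))
    have h2 : w ∈ maximalIdealSq k O := by
      have : RingHom.ker (algebraMap O κ) = maximalIdeal O := ker_residue
      rw [this] at h1
      exact h1
    have h3 : w = 0 := by
      -- With `w = p y`, both `w` and `w - y` lie in `m²` and are killed by `p`, whence `w = p y = p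
      -- w = 0`.
      obtain ⟨y, -, hy⟩ := hwW
      have h := hp _ (hp' y)
      rwa [map_sub, hy, hp w h2, zero_sub, neg_eq_zero] at h
    intro i
    rw [← hc, Fintype.linearIndependent_iff.mp hf c h3 i, map_zero]
  have := hli.fintype_card_le_finrank
  rwa [Module.finrank_baseChange] at this

/-- By induction on `j`, `a x - x` lies in `m ^ j` for all `x`; the powers of `m` intersect in zero.
-/
theorem algHom_eq_id_of_forall_eq [IsNoetherianRing O]
    (hres : ∀ x : O, ∃ c : k, x - algebraMap k O c ∈ maximalIdeal O) {ι : Type*} (f : ι → O)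
    (hf : Submodule.span O (Set.range f) = maximalIdeal O) (a : O →ₐ[k] O)
    (ha : ∀ i, a (f i) = f i) : a = AlgHom.id k O := by
  have key (j : ℕ) : ∀ x, a x - x ∈ maximalIdeal O ^ j := by
    induction j with
    | zero => simp
    | succ j ih =>
      have h (x : O) (hx : x ∈ Submodule.span O (Set.range f)) :
          a x - x ∈ maximalIdeal O ^ (j + 1) := by
        induction hx using Submodule.span_induction with
        | mem x hx =>
          obtain ⟨i, rfl⟩ := hx
          simp [ha i]
        | zero => simp
        | add x y _ _ hx hy =>
          rw [map_add, add_sub_add_comm]; exact add_mem hx hy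
        | smul r x hx' hx =>
          have : a (r • x) - r • x = a r * (a x - x) + (a r - r) * x := by
            rw [smul_eq_mul, map_mul]; ring
          rw [this, pow_succ]
          rw [pow_succ] at hx
          exact add_mem (Ideal.mul_mem_left _ _ hx) (Ideal.mul_mem_mul (ih r) (hf ▸ hx'))
      intro x
      obtain ⟨c, hc⟩ := hres x
      have := h _ (hf ▸ hc)
      rwa [map_sub, AlgHom.commutes, sub_sub_sub_cancel_right] at this
  ext x
  have : a x - x ∈ ⨅ j, maximalIdeal O ^ j := by simpa using fun j ↦ key j x
  rw [Ideal.iInf_pow_eq_bot_of_isLocalRing _ (maximalIdeal.isMaximal O).ne_top] at this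
  exact sub_eq_zero.mp this

theorem exists_equivariant_coordinates [CharZero k] [IsDomain O] [IsNoetherianRing O]
    [Algebra.EssFiniteType k O] [Algebra.FormallySmooth k O]
    (K : Type u) [Field K] [Algebra O K] [IsFractionRing O K] [Algebra k K] [IsScalarTower k O K]
    {n : ℕ} (hn : Algebra.trdeg k K = n)
    (hres : ∀ x : O, ∃ c : k, x - algebraMap k O c ∈ maximalIdeal O)
    {G : Type v} [Group G] [Finite G] (a : G → O →ₐ[k] O) (h1 : a 1 = AlgHom.id k O)
    (hmul : ∀ g h, a (g * h) = (a h).comp (a g)) :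
    ∃ (τ : G →* GL (Fin n) k) (f : Fin n → O), AlgebraicIndependent k f ∧
      (∀ g i, a g (f i) = ∑ j, algebraMap k O ((τ g : Matrix _ _ k) i j) * f j) ∧
      ∀ g, τ g = 1 → a g = AlgHom.id k O := by
  have hinv (g : G) (x : O) : a g⁻¹ (a g x) = x := by
    rw [← AlgHom.comp_apply, ← hmul, mul_inv_cancel, h1, AlgHom.id_apply]
  have hloc (g : G) (x : O) (hx : x ∈ maximalIdeal O) : a g x ∈ maximalIdeal O := by
    rw [mem_maximalIdeal, mem_nonunits_iff] at *
    intro h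
    have := h.map (a g⁻¹)
    rw [hinv] at this
    exact hx this
  obtain ⟨p, hp, hp', hpa⟩ := exists_equivariant_projection (fun g ↦ (a g).toLinearMap)
    (by rw [h1]; rfl) (fun g h ↦ by rw [hmul]; rfl) (maximalIdealSq k O) (fun g x hx ↦ by
      have h : (maximalIdeal O).map (a g) ≤ maximalIdeal O := Ideal.map_le_iff_le_comap.mpr (hloc g)
      have := Ideal.mem_map_of_mem (a g) hx
      rw [Ideal.map_pow] at this
      exact Ideal.pow_right_mono h 2 this)
  set W := ((maximalIdeal O).restrictScalars k).map p with hW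
  have : Module.Finite k W := finite_map_maximalIdeal hres p hp
  -- Formal smoothness makes `Ω[O⁄k]` projective; being finite over a local ring, it is free.
  have hfree : Module.Free O (Ω[O⁄k]) := Module.free_of_flat_of_isLocalRing
  have hspan {m : ℕ} (b : Module.Basis (Fin m) k W) :
      W = Submodule.span k (Set.range fun i ↦ (b i : O)) := by
    have := congr(($(b.span_eq)).map W.subtype)
    rw [Submodule.map_span, Submodule.map_subtype_top, ← Set.range_comp] at this
    exact this.symm
  have hKess : Algebra.EssFiniteType k K := by
    have : Algebra.EssFiniteType O K := .of_isLocalization _ (nonZeroDivisors O)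
    exact .comp k O K
  have halg {m : ℕ} (b : Module.Basis (Fin m) k W) :
      Algebra.IsAlgebraic (Algebra.adjoin k (Set.range fun i ↦ algebraMap O K (b i))) K :=
    isAlgebraic_adjoin_of_span_D_eq_top _ (span_D_eq_top_of_isFractionRing _
      (span_D_eq_top hres _ (span_eq_maximalIdeal p hp' _ (hspan b))))
  have hdim : Module.finrank k W = n := by
    have b := Module.finBasis k W
    refine le_antisymm ?_ ?_
    · have h := card_le_finrank_kaehlerDifferential hres p hp hp' (fun i ↦ (b i : O))
        (b.linearIndependent.map' W.subtype (Submodule.ker_subtype _)) (fun i ↦ (b i).2)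
      rw [Fintype.card_fin, ← finrank_kaehlerDifferential_eq_of_isFractionRing (K := K)] at h
      exact h.trans (finrank_kaehlerDifferential_le hn)
    · have := halg b
      have h := Cardinal.mk_range_le_lift (f := fun i ↦ algebraMap O K (b i))
      simp only [Cardinal.lift_uzero, Cardinal.mk_fin, Cardinal.lift_natCast] at h
      exact_mod_cast hn ▸ (Algebra.IsAlgebraic.trdeg_le_cardinalMk k _).trans h
  let b := Module.finBasisOfFinrankEq k W hdim
  have hW' (g : G) : ∀ x ∈ W, (a g).toLinearMap x ∈ W := by
    rintro _ ⟨x, hx, rfl⟩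
    exact hpa g x ▸ Submodule.mem_map_of_mem (hloc g x hx)
  let T (g : G) : W →ₗ[k] W := (a g).toLinearMap.restrict (hW' g)
  -- Pullback of functions reverses products; transposing restores a homomorphism and matches the
  -- convention of `linPullback`.
  let M : G →* Matrix (Fin n) (Fin n) k :=
    { toFun := fun g ↦ (LinearMap.toMatrix b b (T g)).transpose
      map_one' := by
        have : T 1 = LinearMap.id := by
          ext x
          exact congr($h1 x)
        rw [this, LinearMap.toMatrix_id, Matrix.transpose_one]
      map_mul' := fun g h ↦ by
        have : T (g * h) = T h ∘ₗ T g := by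
          ext x
          exact congr($(hmul g h) x)
        rw [this, LinearMap.toMatrix_comp b b b, Matrix.transpose_mul] }
  have hM (g : G) (i : Fin n) : a g (b i) = ∑ j, algebraMap k O (M g i j) * b j := by
    have := congr(($(b.sum_repr (T g (b i))) : O))
    rw [Submodule.coe_sum] at this
    refine this.symm.trans (Finset.sum_congr rfl fun j _ ↦ ?_)
    rw [Submodule.coe_smul, Algebra.smul_def]
    simp only [M, MonoidHom.coe_mk, OneHom.coe_mk, Matrix.transpose_apply, LinearMap.toMatrix_apply]
  refine ⟨MonoidHom.toHomUnits M, fun i ↦ b i, ?_, hM, fun g hg ↦ ?_⟩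
  · have := halg b
    refine AlgebraicIndependent.of_comp (IsScalarTower.toAlgHom k O K) ?_
    -- The `n` elements have a field of transcendence degree `n` algebraic over them, so they form a
    -- transcendence basis.
    exact (Algebra.IsAlgebraic.isTranscendenceBasis_of_lift_le_trdeg_of_finite k
      (fun i ↦ algebraMap O K (b i)) (by simp [hn])).1
  · refine algHom_eq_id_of_forall_eq hres _ (span_eq_maximalIdeal p hp' _ (hspan b)) (a g) ?_
    intro i
    have hg' : M g = 1 := congr(($hg : Matrix (Fin n) (Fin n) k))
    rw [hM, hg', Finset.sum_eq_single i]
    · simp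
    · intro j _ hj
      simp [Matrix.one_apply_ne hj.symm]
    · simp

end LocalCoordinates

/-! ### A non-birational equivariant self-map of a linear representation -/

section SelfMaps

open MvPolynomial

variable {k : Type u} [Field k] {n : ℕ}

theorem eval_linPullback (A : Matrix (Fin n) (Fin n) k) (v : Fin n → k)
    (P : MvPolynomial (Fin n) k) : eval v (linPullback k n A P) = eval (A.mulVec v) P := by
  have h : (aeval v).comp (linPullback k n A) = aeval (A.mulVec v) := by
    ext i
    simp [linPullback, Matrix.mulVec, dotProduct]
  exact congr($h P)

/-- The pullback of polynomial functions along the map `v ↦ q(v) v`. -/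
def scalePullback (q : MvPolynomial (Fin n) k) :
    MvPolynomial (Fin n) k →ₐ[k] MvPolynomial (Fin n) k :=
  aeval fun i ↦ q * X i

theorem eval_scalePullback (q : MvPolynomial (Fin n) k) (v : Fin n → k)
    (P : MvPolynomial (Fin n) k) : eval v (scalePullback q P) = eval (eval v q • v) P := by
  have h : (aeval v).comp (scalePullback q) = aeval (eval v q • v) := by
    ext i
    simp [scalePullback, aeval_def, eval₂_eq_eval_map]
  exact congr($h P)

/-- Reduces identities between self-maps of `kⁿ` to identities on `k`-points. -/
theorem algHom_ext_eval [Infinite k] {f g : MvPolynomial (Fin n) k →ₐ[k] MvPolynomial (Fin n) k}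
    (h : ∀ v P, eval v (f P) = eval v (g P)) : f = g :=
  AlgHom.ext fun P ↦ MvPolynomial.funext fun v ↦ h v P

theorem scalePullback_injective [IsAlgClosed k] {q : MvPolynomial (Fin n) k} (hq : q ≠ 0) {e : ℕ}
    (he : ∀ (t : k) v, eval (t • v) q = t ^ e * eval v q) :
    Function.Injective (scalePullback q) := by
  have : Infinite k := IsAlgClosed.instInfinite
  rw [injective_iff_map_eq_zero]
  intro P hP
  have : P * q = 0 := by
    refine MvPolynomial.funext fun v ↦ ?_
    rw [map_mul, map_zero, mul_eq_zero, or_iff_not_imp_right]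
    intro hv
    -- When `q(v) ≠ 0`, `v` is the image of `t v`, because `q(t v) t = t ^ (e + 1) q(v) = 1`. Hence
    -- `P` vanishes wherever `q` does not.
    obtain ⟨t, ht⟩ := IsAlgClosed.exists_pow_nat_eq (eval v q)⁻¹ e.succ_pos
    have h := eval_scalePullback q (t • v) P
    have h1 : eval (t • v) q • t • v = v := by
      rw [he, smul_smul, mul_right_comm, ← pow_succ, ht, inv_mul_cancel₀ hv, one_smul]
    rw [hP, map_zero, h1] at h
    exact h.symm
  exact (mul_eq_zero.mp this).resolve_right hq

theorem isDominant_Spec_map {R S : CommRingCat.{u}} (φ : R ⟶ S)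
    (hφ : Function.Injective φ.hom) : IsDominant (Spec.map φ) :=
  ⟨(PrimeSpectrum.denseRange_comap_iff_ker_le_nilRadical _).mpr
    (((RingHom.injective_iff_ker_eq_bot _).mp hφ).le.trans bot_le)⟩

instance : IsSeparated (linSpace k n ↘ Spec (.of k)) :=
  inferInstanceAs (IsSeparated (Spec.map _))

instance : LocallyOfFiniteType (linSpace k n ↘ Spec (.of k)) := by
  change LocallyOfFiniteType (Spec.map _)
  rw [HasRingHomProperty.Spec_iff (P := @LocallyOfFiniteType)]
  exact RingHom.finiteType_algebraMap.mpr
    (inferInstanceAs (Algebra.FiniteType k (MvPolynomial (Fin n) k)))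

/-- The regular self-map of `kⁿ` given by an endomorphism of `k[x₁, …, xₙ]`. -/
def selfHom (f : MvPolynomial (Fin n) k →ₐ[k] MvPolynomial (Fin n) k) :
    linSpace k n ⟶ linSpace k n :=
  Spec.map (CommRingCat.ofHom f.toRingHom)

theorem selfHom_comp (f g : MvPolynomial (Fin n) k →ₐ[k] MvPolynomial (Fin n) k) :
    selfHom f ≫ selfHom g = selfHom (f.comp g) :=
  (Spec.map_comp _ _).symm

theorem selfHom_injective : Function.Injective (selfHom (k := k) (n := n)) := fun f g h ↦ by
  have h' := Spec.map_injective h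
  exact AlgHom.ext fun x ↦ congr($(h').hom x)

instance (f : MvPolynomial (Fin n) k →ₐ[k] MvPolynomial (Fin n) k) :
    (selfHom f).IsOver (Spec (.of k)) := ⟨by
  change Spec.map _ ≫ Spec.map _ = Spec.map _
  rw [← Spec.map_comp, ← CommRingCat.ofHom_comp]
  congr 2
  exact f.comp_algebraMap⟩

theorem isDominant_selfHom {f : MvPolynomial (Fin n) k →ₐ[k] MvPolynomial (Fin n) k}
    (hf : Function.Injective f) : IsDominant (selfHom f) :=
  isDominant_Spec_map _ hf

/-- Morphisms from an integral scheme to a separated one that agree on a dense open subset are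
equal. -/
theorem DomRatMap.ofHom_injective {S X Y : Scheme.{u}} [X.Over S] [Y.Over S] [IsIntegral X]
    [IsSeparated (Y ↘ S)] {f g : X ⟶ Y} [IsDominant f] [IsDominant g] [f.IsOver S] [g.IsOver S]
    (h : (DomRatMap.ofHom f : DomRatMap S X Y) = DomRatMap.ofHom g) : f = g := by
  have h' := Scheme.PartialMap.toRationalMap_eq_iff.mp congr(($h).toRationalMap)
  have h'' := (Scheme.PartialMap.equiv_toPartialMap_iff_of_isSeparated (S := S)).mp h'
  exact (cancel_epi X.topIso.hom).mp h''

/-- The regular dominant self-map of `kⁿ` given by an injective endomorphism of `k[x₁, …, xₙ]`. -/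
def selfMap (f : MvPolynomial (Fin n) k →ₐ[k] MvPolynomial (Fin n) k)
    (hf : Function.Injective f) : DomRatMap (Spec (.of k)) (linSpace k n) (linSpace k n) :=
  haveI := isDominant_selfHom hf
  DomRatMap.ofHom (selfHom f)

theorem selfMap_comp {f g h : MvPolynomial (Fin n) k →ₐ[k] MvPolynomial (Fin n) k}
    (hf : Function.Injective f) (hg : Function.Injective g) (hh : Function.Injective h)
    (e : f.comp g = h) : (selfMap f hf).comp (selfMap g hg) = selfMap h hh := by
  have := isDominant_selfHom hf
  have := isDominant_selfHom hg
  have := isDominant_selfHom hh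
  have e' : selfHom f ≫ selfHom g = selfHom h := by rw [selfHom_comp, e]
  have : IsDominant (selfHom f ≫ selfHom g) := e' ▸ this
  refine (DomRatMap.ofHom_comp_ofHom _ _).trans (DomRatMap.ext ?_)
  exact congr(Scheme.Hom.toRationalMap $e')

theorem selfMap_id :
    selfMap (.id k _) Function.injective_id = DomRatMap.id (Spec (.of k)) (linSpace k n) :=
  DomRatMap.ext congr(Scheme.Hom.toRationalMap $(Spec.map_id _))

theorem selfMap_injective {f g : MvPolynomial (Fin n) k →ₐ[k] MvPolynomial (Fin n) k}
    {hf : Function.Injective f} {hg : Function.Injective g} (h : selfMap f hf = selfMap g hg) :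
    f = g := by
  have := isDominant_selfHom hf
  have := isDominant_selfHom hg
  exact selfHom_injective (DomRatMap.ofHom_injective h)

theorem linPullback_one : linPullback k n 1 = AlgHom.id k _ := by
  ext i : 1
  simp [linPullback, Matrix.one_apply]

theorem linPullback_mul (A B : Matrix (Fin n) (Fin n) k) :
    linPullback k n (A * B) = (linPullback k n B).comp (linPullback k n A) := by
  ext i : 1
  simp [linPullback, Matrix.mul_apply, Finset.sum_mul, Finset.mul_sum, mul_assoc]
  rw [Finset.sum_comm]

theorem linPullback_injective (A : GL (Fin n) k) :
    Function.Injective (linPullback k n (A : Matrix (Fin n) (Fin n) k)) := by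
  refine Function.LeftInverse.injective
    (g := linPullback k n ((A⁻¹ : GL (Fin n) k) : Matrix (Fin n) (Fin n) k)) fun x ↦ ?_
  rw [← AlgHom.comp_apply, ← linPullback_mul, ← Units.val_mul, mul_inv_cancel, Units.val_one,
    linPullback_one, AlgHom.id_apply]

theorem glToBir_eq_selfMap (A : GL (Fin n) k) :
    (glToBir k n A : DomRatMap (Spec (.of k)) (linSpace k n) (linSpace k n)) =
      selfMap (linPullback k n (A : Matrix (Fin n) (Fin n) k)) (linPullback_injective A) :=
  rfl

/-- The norm of a coordinate function under a linear action of a finite group. -/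
def coordNorm {G : Type*} [Group G] [Fintype G] (τ : G →* GL (Fin n) k) (i : Fin n) :
    MvPolynomial (Fin n) k :=
  ∏ g, linPullback k n (τ g : Matrix (Fin n) (Fin n) k) (X i)

section coordNorm

variable {G : Type*} [Group G] [Fintype G] (τ : G →* GL (Fin n) k) (i : Fin n)

theorem eval_coordNorm (v : Fin n → k) :
    eval v (coordNorm τ i) = ∏ g, (τ g : Matrix (Fin n) (Fin n) k).mulVec v i := by
  simp [coordNorm, map_prod, eval_linPullback]

theorem coordNorm_ne_zero : coordNorm τ i ≠ 0 :=
  Finset.prod_ne_zero_iff.mpr fun g _ ↦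
    (map_ne_zero_iff _ (linPullback_injective (τ g))).mpr (X_ne_zero i)

theorem eval_smul_coordNorm (t : k) (v : Fin n → k) :
    eval (t • v) (coordNorm τ i) = t ^ Fintype.card G * eval v (coordNorm τ i) := by
  simp [eval_coordNorm, Matrix.mulVec_smul, Finset.prod_mul_distrib]

theorem eval_mulVec_coordNorm (h : G) (v : Fin n → k) :
    eval ((τ h : Matrix (Fin n) (Fin n) k).mulVec v) (coordNorm τ i) =
      eval v (coordNorm τ i) := by
  rw [eval_coordNorm, eval_coordNorm]
  refine Fintype.prod_equiv (Equiv.mulRight h) _ _ fun g ↦ ?_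
  rw [Equiv.coe_mulRight, Matrix.mulVec_mulVec, map_mul, Units.val_mul]

end coordNorm

/-- For `q` the norm of a coordinate, invariance of `q` makes `v ↦ q(v) v` equivariant. If `ζ` has
order `|G| + 1`, then `q(ζ v) ζ v = q(v) v`, so the map absorbs a nontrivial scaling and has no
inverse. -/
theorem exists_isEquivariant_not_isBirational [IsAlgClosed k] [CharZero k] {G : Type v} [Group G]
    [Finite G] (τ : G →* GL (Fin n) k) (i : Fin n) :
    ∃ φ : DomRatMap (Spec (.of k)) (linSpace k n) (linSpace k n),
      IsEquivariant ((glToBir k n).comp τ) ((glToBir k n).comp τ) φ ∧ ¬ φ.IsBirational := by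
  have := Fintype.ofFinite G
  have hinf : Infinite k := IsAlgClosed.instInfinite
  set q := coordNorm τ i
  have hq : Function.Injective (scalePullback q) :=
    scalePullback_injective (coordNorm_ne_zero τ i) (eval_smul_coordNorm τ i)
  have hcomp (f : MvPolynomial (Fin n) k →ₐ[k] MvPolynomial (Fin n) k)
      (hf : Function.Injective f) : Function.Injective (f.comp (scalePullback q)) := hf.comp hq
  refine ⟨selfMap _ hq, fun g ↦ ?_, ?_⟩
  · rw [MonoidHom.comp_apply, glToBir_eq_selfMap,
      selfMap_comp (hh := hcomp _ (linPullback_injective _)) (e := rfl),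
      selfMap_comp (hh := hcomp _ (linPullback_injective _))]
    refine algHom_ext_eval fun v P ↦ ?_
    rw [AlgHom.comp_apply, AlgHom.comp_apply, eval_scalePullback, eval_linPullback,
      eval_linPullback, eval_scalePullback, eval_mulVec_coordNorm, Matrix.mulVec_smul]
  · rintro ⟨b, hb, -⟩
    obtain ⟨ζ, hζ⟩ : ∃ ζ : k, IsPrimitiveRoot ζ (Fintype.card G + 1) := by
      have : NeZero ((Fintype.card G + 1 : ℕ) : k) := ⟨Nat.cast_ne_zero.mpr (Nat.succ_ne_zero _)⟩
      obtain ⟨ζ, hζ⟩ := IsAlgClosed.exists_root (Polynomial.cyclotomic (Fintype.card G + 1) k)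
        (Polynomial.degree_cyclotomic_pos _ k (Nat.succ_pos _)).ne'
      exact ⟨ζ, Polynomial.isRoot_cyclotomic_iff.mp hζ⟩
    have hζ0 : ζ ≠ 0 := hζ.ne_zero (Nat.succ_ne_zero _)
    let A : GL (Fin n) k := Matrix.scalar (Fin n) |>.toMonoidHom |> Units.map <| Units.mk0 ζ hζ0
    have hA (v : Fin n → k) : (A : Matrix (Fin n) (Fin n) k).mulVec v = ζ • v := by
      simp [A]
    have h1 : (selfMap _ (linPullback_injective A)).comp (selfMap _ hq) = selfMap _ hq := by
      refine selfMap_comp _ _ _ (algHom_ext_eval fun v P ↦ ?_)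
      rw [AlgHom.comp_apply, eval_linPullback, eval_scalePullback, eval_scalePullback, hA,
        eval_smul_coordNorm, smul_smul, mul_right_comm, ← pow_succ, hζ.pow_eq_one, one_mul]
    have h2 : selfMap _ (linPullback_injective A) = selfMap (.id k _) Function.injective_id := by
      rw [← DomRatMap.comp_id (selfMap _ (linPullback_injective A)), ← hb, ← DomRatMap.comp_assoc,
        h1, hb, selfMap_id]
    have h3 := congr(eval 1 ($(selfMap_injective h2) (X i)))
    rw [eval_linPullback, hA] at h3
    have h4 : ζ = 1 := by simpa using h3
    have := hζ.unique (h4 ▸ IsPrimitiveRoot.one)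
    have := Fintype.card_pos (α := G)
    omega

end SelfMaps

/-! ### Stalks as `k`-algebras and germs of rational maps -/

section Stalks

variable {k : Type u} [Field k] {X Y : Scheme.{u}} [X.Over (Spec (.of k))] [Y.Over (Spec (.of k))]

/-- The stalks of a scheme over `k` are `k`-algebras. -/
abbrev stalkAlgebra (k : Type u) [Field k] (X : Scheme.{u}) [X.Over (Spec (.of k))] (x : X) :
    Algebra k (X.presheaf.stalk x) :=
  (baseToStalk X x).hom.toAlgebra

theorem baseToStalk_comp_stalkSpecializes {x y : X} (h : x ⤳ y) :
    baseToStalk (k := k) X y ≫ X.presheaf.stalkSpecializes h = baseToStalk X x := by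
  apply Spec.map_injective
  rw [Spec.map_comp, Spec_map_baseToStalk, Spec_map_baseToStalk,
    Scheme.SpecMap_stalkSpecializes_fromSpecStalk_assoc]

/-- The point `y` is a separate variable so that at a fixed point source and target are literally
the same stalk. -/
theorem exists_stalk_hom (s : X ⟶ Y) {x : X} {y : Y} (h : s x = y) :
    ∃ a : Y.presheaf.stalk y ⟶ X.presheaf.stalk x,
      Spec.map a ≫ Y.fromSpecStalk y = X.fromSpecStalk x ≫ s := by
  subst h
  exact ⟨s.stalkMap x, Scheme.SpecMap_stalkMap_fromSpecStalk s⟩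

theorem baseToStalk_comp {s : X ⟶ Y} [s.IsOver (Spec (.of k))] {x : X} {y : Y}
    {a : Y.presheaf.stalk y ⟶ X.presheaf.stalk x}
    (ha : Spec.map a ≫ Y.fromSpecStalk y = X.fromSpecStalk x ≫ s) :
    baseToStalk (k := k) Y y ≫ a = baseToStalk X x := by
  apply Spec.map_injective
  rw [Spec.map_comp, Spec_map_baseToStalk, Spec_map_baseToStalk, reassoc_of% ha, comp_over]

theorem exists_isIso_Spec_map_eq_fromSpecStalk (p : Spec (.of k)) :
    ∃ e : CommRingCat.of k ⟶ (Spec (.of k)).presheaf.stalk p, IsIso e ∧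
      Spec.map e = (Spec (.of k)).fromSpecStalk p := by
  have : Subsingleton (PrimeSpectrum (CommRingCat.of k)) :=
    inferInstanceAs (Subsingleton (PrimeSpectrum k))
  obtain rfl : p = IsLocalRing.closedPoint (CommRingCat.of k) :=
    Subsingleton.elim (α := PrimeSpectrum (CommRingCat.of k)) _ _
  refine ⟨(AlgebraicGeometry.stalkClosedPointIso (.of k)).inv, inferInstance, ?_⟩
  exact (congrArg Spec.map (stalkClosedPointIso_inv (.of k))).trans
    (Spec.fromSpecStalk_eq' _ _).symm

/-- Transfers properties of the stalk maps of the structure morphism to the `k`-algebra structure of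
the stalk. -/
theorem exists_isIso_baseToStalk_eq (x : X) :
    ∃ e : CommRingCat.of k ⟶ (Spec (.of k)).presheaf.stalk ((X ↘ Spec (.of k)) x), IsIso e ∧
      baseToStalk X x = e ≫ (X ↘ Spec (.of k)).stalkMap x := by
  obtain ⟨e, he, h⟩ := exists_isIso_Spec_map_eq_fromSpecStalk ((X ↘ Spec (.of k)) x)
  refine ⟨e, he, Spec.map_injective ?_⟩
  rw [Spec_map_baseToStalk, Spec.map_comp, h, Scheme.SpecMap_stalkMap_fromSpecStalk]

theorem essFiniteType_stalk [LocallyOfFiniteType (X ↘ Spec (.of k))] (x : X) :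
    letI := stalkAlgebra k X x
    Algebra.EssFiniteType k (X.presheaf.stalk x) := by
  obtain ⟨e, he, h⟩ := exists_isIso_baseToStalk_eq (k := k) x
  change (baseToStalk X x).hom.EssFiniteType
  rw [h, CommRingCat.hom_comp]
  exact (RingHom.EssFiniteType.respectsIso.cancel_left_isIso e _).mpr
    (LocallyOfFiniteType.stalkMap _ x)

theorem formallySmooth_stalk [Smooth (X ↘ Spec (.of k))] (x : X) :
    letI := stalkAlgebra k X x
    Algebra.FormallySmooth k (X.presheaf.stalk x) := by
  obtain ⟨e, he, h⟩ := exists_isIso_baseToStalk_eq (k := k) x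
  change (baseToStalk X x).hom.FormallySmooth
  rw [h, CommRingCat.hom_comp]
  exact (RingHom.FormallySmooth.respectsIso.cancel_left_isIso e _).mpr
    ((Scheme.Hom.smoothLocus_eq_top (X ↘ Spec (.of k))).ge trivial)

/-- Evaluation at the rational point is a `k`-algebra retraction to `k`; it kills `f - f(x)`, which
is thus a nonunit. -/
theorem exists_sub_mem_maximalIdeal_stalk (x : Spec (.of k) ⟶ X)
    (hx : x ≫ (X ↘ Spec (.of k)) = 𝟙 _)
    (f : X.presheaf.stalk (x (IsLocalRing.closedPoint k))) :
    ∃ c : k, f - (baseToStalk X _).hom c ∈ IsLocalRing.maximalIdeal _ := by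
  have h : baseToStalk X _ ≫ Scheme.stalkClosedPointTo x = 𝟙 _ := by
    apply Spec.map_injective
    rw [Spec.map_comp, Spec_map_baseToStalk, Spec.map_id,
      Scheme.Spec_stalkClosedPointTo_fromSpecStalk_assoc, hx]
  refine ⟨(Scheme.stalkClosedPointTo x).hom f, ?_⟩
  rw [IsLocalRing.mem_maximalIdeal, mem_nonunits_iff]
  intro hu
  have := hu.map (Scheme.stalkClosedPointTo x).hom
  have h' (c : k) : (Scheme.stalkClosedPointTo x).hom ((baseToStalk X _).hom c) = c :=
    congr($(h).hom c)
  rw [map_sub, h', sub_self] at this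
  exact not_isUnit_zero this

theorem fromSpecStalkOfMem_toPartialMap_comp {X Y Z : Scheme.{u}} [PreirreducibleSpace X]
    [Nonempty Y] (s : X ⟶ Y) [IsDominant s] (g : Y.PartialMap Z) {x : X} {y : Y}
    (hx : x ∈ (s.toPartialMap.comp g).domain) (hy : y ∈ g.domain)
    (a : Y.presheaf.stalk y ⟶ X.presheaf.stalk x)
    (ha : Spec.map a ≫ Y.fromSpecStalk y = X.fromSpecStalk x ≫ s) :
    (s.toPartialMap.comp g).fromSpecStalkOfMem hx = Spec.map a ≫ g.fromSpecStalkOfMem hy := by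
  have e : ((s.toPartialMap.domain.ι.isoImage _).inv ≫ s.toPartialMap.hom ∣_ g.domain) ≫
      g.domain.ι = (s.toPartialMap.domain.ι ''ᵁ s.toPartialMap.hom ⁻¹ᵁ g.domain).ι ≫ s := by
    rw [Category.assoc, morphismRestrict_ι, Scheme.Opens.isoImage_ι_inv_ι_assoc]
    exact Scheme.homOfLE_ι_assoc X _ s
  have h : (s.toPartialMap.comp g).domain.fromSpecStalkOfMem x hx ≫
      ((s.toPartialMap.domain.ι.isoImage _).inv ≫ s.toPartialMap.hom ∣_ g.domain) =
      Spec.map a ≫ g.domain.fromSpecStalkOfMem y hy := by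
    rw [← cancel_mono g.domain.ι]
    simp only [Category.assoc, Scheme.Opens.fromSpecStalkOfMem_ι, ha]
    rw [← Scheme.Opens.fromSpecStalkOfMem_ι _ x hx, Category.assoc]
    congr 1
  rw [Scheme.PartialMap.fromSpecStalkOfMem, Scheme.PartialMap.fromSpecStalkOfMem, ← reassoc_of% h]
  rfl

end Stalks

/-! ### From a fixed point to an equivariant map into a linear representation -/

section FixedPoint

variable {k : Type u} [Field k] {Y : Scheme.{u}} [Y.Over (Spec (.of k))]

theorem stalk_hom_ext {X : Scheme.{u}} {x y : X} {a b : X.presheaf.stalk y ⟶ X.presheaf.stalk x}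
    (h : Spec.map a ≫ X.fromSpecStalk y = Spec.map b ≫ X.fromSpecStalk y) : a = b :=
  Spec.map_injective ((cancel_mono _).mp h)

theorem exists_stalk_action {G : Type v} [Group G] (σ : G →* AutOver (Spec (.of k)) Y) {y : Y}
    (hy : ∀ g, (σ g).toHom y = y) :
    letI := stalkAlgebra k Y y
    ∃ a : G → Y.presheaf.stalk y →ₐ[k] Y.presheaf.stalk y,
      (∀ g, Spec.map (CommRingCat.ofHom (a g).toRingHom) ≫ Y.fromSpecStalk y =
        Y.fromSpecStalk y ≫ (σ g).toHom) ∧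
      a 1 = AlgHom.id k _ ∧ ∀ g h, a (g * h) = (a h).comp (a g) := by
  let := stalkAlgebra k Y y
  choose a ha using fun g ↦ exists_stalk_hom (σ g).toHom (hy g)
  let b (g : G) : Y.presheaf.stalk y →ₐ[k] Y.presheaf.stalk y :=
    { (a g).hom with
      commutes' := fun c ↦ congr(($(baseToStalk_comp (k := k) (ha g))).hom c) }
  refine ⟨b, ha, ?_, fun g h ↦ ?_⟩
  · have : a 1 = 𝟙 _ := by
      refine stalk_hom_ext ?_
      rw [ha, map_one, Spec.map_id, Category.id_comp]
      exact Category.comp_id _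
    exact AlgHom.ext fun x ↦ congr(($this).hom x)
  · have : a (g * h) = a g ≫ a h := by
      refine stalk_hom_ext ?_
      rw [ha, map_mul, Spec.map_comp, Category.assoc, ha, reassoc_of% (ha h)]
      rfl
    exact AlgHom.ext fun x ↦ congr(($this).hom x)

/-- The morphism from the local scheme at `y` given by `f` spreads out to a neighbourhood of `y`. It
is dominant because algebraic independence makes the pullback of polynomials injective. -/
theorem exists_partialMap_linSpace [IsIntegral Y] {n : ℕ} {y : Y}
    (f : Fin n → Y.presheaf.stalk y)
    (hf : letI := stalkAlgebra k Y y; AlgebraicIndependent k f) :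
    letI := stalkAlgebra k Y y
    ∃ (Φ : Y.PartialMap (linSpace k n)) (hy : y ∈ Φ.domain),
      IsDominant Φ.hom ∧ Φ.IsOver (Spec (.of k)) ∧ Φ.fromSpecStalkOfMem hy =
        Spec.map (CommRingCat.ofHom (MvPolynomial.aeval (R := k) f).toRingHom) := by
  let := stalkAlgebra k Y y
  set p : Spec (Y.presheaf.stalk y) ⟶ linSpace k n :=
    Spec.map (CommRingCat.ofHom (MvPolynomial.aeval (R := k) f).toRingHom) with hp
  have hover : p ≫ (linSpace k n ↘ Spec (.of k)) = Y.fromSpecStalk y ≫ (Y ↘ Spec (.of k)) := by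
    rw [← Spec_map_baseToStalk]
    refine (Spec.map_comp _ _).symm.trans (congrArg Spec.map ?_)
    ext c
    exact (MvPolynomial.aeval (R := k) f).commutes c
  have hdom : IsDominant p := isDominant_Spec_map _ hf
  have hstalk := Scheme.PartialMap.fromSpecStalkOfMem_ofFromSpecStalk
    (Y ↘ Spec (.of k)) (linSpace k n ↘ Spec (.of k)) p hover
  refine ⟨_, _, ?_, ?_, hstalk⟩
  · rw [← hstalk] at hdom
    exact IsDominant.of_comp _ _ (H := hdom)
  · rw [Scheme.PartialMap.isOver_iff]
    exact Scheme.PartialMap.ofFromSpecStalk_comp _ _ _ _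

/-- Rational maps defined at the fixed point agree once their germs there agree, so equivariance and
faithfulness both become statements about the action on the local ring. -/
theorem exists_equivariant_of_fixed_point [CharZero k] [IsIntegral Y] [Smooth (Y ↘ Spec (.of k))]
    {n : ℕ} (hn : letI := stalkAlgebra k Y (genericPoint Y); Algebra.trdeg k Y.functionField = n)
    {G : Type v} [Group G] [Finite G] (σ : G →* AutOver (Spec (.of k)) Y)
    (y : Spec (.of k) ⟶ Y) (hy : y ≫ (Y ↘ Spec (.of k)) = 𝟙 _)
    (hσ : ∀ g : G, y ≫ (σ g).toHom = y) :
    ∃ (τ : G →* Matrix.GeneralLinearGroup (Fin n) k)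
      (φ : DomRatMap (Spec (.of k)) Y (linSpace k n)),
      IsEquivariant ((autToBir _ Y).comp σ) ((glToBir k n).comp τ) φ ∧
        ∀ g, τ g = 1 → autToBir (Spec (.of k)) Y (σ g) = 1 := by
  set y₀ := y (IsLocalRing.closedPoint k)
  have hy₀ (g : G) : (σ g).toHom y₀ = y₀ := congr($(hσ g) (IsLocalRing.closedPoint k))
  let := stalkAlgebra k Y y₀
  let : Algebra k Y.functionField := stalkAlgebra k Y (genericPoint Y)
  have : IsScalarTower k (Y.presheaf.stalk y₀) Y.functionField := .of_algebraMap_eq fun c ↦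
    congr(($(baseToStalk_comp_stalkSpecializes (k := k)
      ((genericPoint_spec Y).specializes (Set.mem_univ y₀)))).hom c).symm
  have := essFiniteType_stalk (k := k) y₀
  have := formallySmooth_stalk (k := k) y₀
  have : IsLocallyNoetherian Y := LocallyOfFiniteType.isLocallyNoetherian (Y ↘ Spec (.of k))
  obtain ⟨a, ha, ha1, hmul⟩ := exists_stalk_action σ hy₀
  obtain ⟨τ, f, hf, hτ, htriv⟩ := exists_equivariant_coordinates (k := k)
    (O := Y.presheaf.stalk y₀) Y.functionField hn (exists_sub_mem_maximalIdeal_stalk y hy) a ha1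
    hmul
  obtain ⟨Φ, hyΦ, hdom, hover, hstalk⟩ := exists_partialMap_linSpace f hf
  refine ⟨τ, ⟨Φ.toRationalMap, inferInstance, inferInstance⟩, fun g ↦ DomRatMap.ext ?_,
    fun g hg ↦ Units.ext (DomRatMap.ext ?_)⟩
  · change (Scheme.Hom.toRationalMap (σ g).toHom).comp Φ.toRationalMap =
      Φ.toRationalMap.comp (selfHom (linPullback k n (τ g : Matrix _ _ k))).toRationalMap
    rw [Scheme.RationalMap.comp_toRationalMap]
    refine (Scheme.RationalMap.toRationalMap_comp (σ g).toHom.toPartialMap Φ).trans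
      (Scheme.PartialMap.toRationalMap_eq_iff.mpr ?_)
    have hmem : y₀ ∈ ((σ g).toHom.toPartialMap.comp Φ).domain :=
      ⟨⟨y₀, trivial⟩, show (σ g).toHom y₀ ∈ Φ.domain from (hy₀ g).symm ▸ hyΦ, rfl⟩
    refine Scheme.PartialMap.equiv_of_fromSpecStalkOfMem_eq _ _ hmem hyΦ
      ((fromSpecStalkOfMem_toPartialMap_comp _ _ hmem hyΦ _ (ha g)).trans
        (.trans ?_ (Scheme.PartialMap.fromSpecStalkOfMem_compHom Φ _ _ hyΦ).symm))
    rw [hstalk]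
    refine (Spec.map_comp _ _).symm.trans (.trans (congrArg Spec.map ?_) (Spec.map_comp _ _))
    have : (a g).comp (MvPolynomial.aeval f) =
        (MvPolynomial.aeval f).comp (linPullback k n (τ g : Matrix _ _ k)) := by
      ext i
      simp [linPullback, hτ]
    exact CommRingCat.hom_ext (RingHom.ext fun P ↦ congr($this P))
  · refine Scheme.PartialMap.toRationalMap_eq_iff.mpr
      (Scheme.PartialMap.equiv_of_fromSpecStalkOfMem_eq (x := y₀) _ _ trivial trivial ?_)
    rw [Scheme.PartialMap.fromSpecStalkOfMem_toPartialMap, ← ha, htriv g hg,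
      Scheme.PartialMap.fromSpecStalkOfMem_toPartialMap, Category.comp_id]
    exact (congrArg (· ≫ Y.fromSpecStalk y₀) (Spec.map_id _)).trans (Category.id_comp _)

end FixedPoint

/-! ### Dominant rational maps and function fields -/

section FunctionField

variable {k : Type u} [Field k] {X Y : Scheme.{u}} [X.Over (Spec (.of k))] [Y.Over (Spec (.of k))]

theorem exists_hom_of_map_closedPoint_eq {R : CommRingCat.{u}} [IsLocalRing R] (s : Spec R ⟶ Y)
    {y : Y} (h : s (IsLocalRing.closedPoint R) = y) :
    ∃ t : Y.presheaf.stalk y ⟶ R, Spec.map t ≫ Y.fromSpecStalk y = s := by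
  subst h
  exact ⟨Scheme.stalkClosedPointTo s, Scheme.Spec_stalkClosedPointTo_fromSpecStalk s⟩

theorem map_genericPoint_eq [IrreducibleSpace X] [IrreducibleSpace Y] (f : X ⟶ Y) [IsDominant f] :
    f (genericPoint X) = genericPoint Y := by
  have h := (genericPoint_spec X).image f.continuous
  rw [Set.image_univ, f.denseRange.closure_range] at h
  exact h.eq (genericPoint_spec Y)

theorem fromFunctionField_closedPoint [IsIntegral X] [IsIntegral Y] (f : X.PartialMap Y)
    [IsDominant f.hom] :
    f.fromFunctionField (IsLocalRing.closedPoint X.functionField) = genericPoint Y := by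
  have hgen : genericPoint X ∈ f.domain :=
    (genericPoint_specializes _).mem_open f.domain.2 f.dense_domain.nonempty.choose_spec
  have : Nonempty f.domain := ⟨⟨_, hgen⟩⟩
  have h : f.domain.fromSpecStalkOfMem _ hgen (IsLocalRing.closedPoint X.functionField) =
      genericPoint f.domain := by
    refine f.domain.ι.injective ?_
    rw [genericPoint_eq_of_isOpenImmersion]
    exact congr($(f.domain.fromSpecStalkOfMem_ι _ hgen) (IsLocalRing.closedPoint _)).trans
      Scheme.fromSpecStalk_closedPoint
  rw [← map_genericPoint_eq f.hom, ← h]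
  rfl

/-- A dominant rational map sends generic point to generic point, hence embeds function fields over
`k`. -/
theorem trdeg_functionField_le [IsIntegral X] [IsIntegral Y] (φ : DomRatMap (Spec (.of k)) X Y) :
    letI := stalkAlgebra k X (genericPoint X)
    letI := stalkAlgebra k Y (genericPoint Y)
    Algebra.trdeg k Y.functionField ≤ Algebra.trdeg k X.functionField := by
  obtain ⟨φ, hdom, hover⟩ := φ
  obtain ⟨f, hf, rfl⟩ := φ.exists_partialMap_over (S := Spec (.of k))
  have : IsDominant f.hom := f.isDominant_toRationalMap_iff.mp hdom
  obtain ⟨t, ht⟩ := exists_hom_of_map_closedPoint_eq _ (fromFunctionField_closedPoint f)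
  have h : baseToStalk (k := k) Y (genericPoint Y) ≫ t = baseToStalk X (genericPoint X) := by
    apply Spec.map_injective
    rw [Spec.map_comp, Spec_map_baseToStalk, Spec_map_baseToStalk, reassoc_of% ht]
    have e : f.hom ≫ (Y ↘ Spec (.of k)) = f.domain.ι ≫ (X ↘ Spec (.of k)) :=
      Scheme.PartialMap.isOver_iff.mp hf
    rw [Scheme.PartialMap.fromFunctionField, Scheme.PartialMap.fromSpecStalkOfMem, Category.assoc,
      e, Scheme.Opens.fromSpecStalkOfMem_ι_assoc]
  let := stalkAlgebra k X (genericPoint X)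
  let := stalkAlgebra k Y (genericPoint Y)
  exact trdeg_le_of_injective (R := k) (A := Y.functionField) (A' := X.functionField)
    { t.hom with commutes' := fun c ↦ congr(($h).hom c) } t.hom.injective

end FunctionField

/-! ### Formal properties of birational and equivariant maps -/

namespace DomRatMap

variable {S X Y Z : Scheme.{u}} [X.Over S] [Y.Over S] [Z.Over S] [IsIntegral X] [IsIntegral Y]
  [IsIntegral Z]

theorem IsBirational.of_comp_left {f : DomRatMap S X Y} {g : DomRatMap S Y Z}
    (hf : f.IsBirational) (hfg : (f.comp g).IsBirational) : g.IsBirational := by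
  obtain ⟨f', h1, h2⟩ := hf
  obtain ⟨e, h3, h4⟩ := hfg
  refine ⟨e.comp f, ?_, by rw [comp_assoc, h4]⟩
  calc g.comp (e.comp f) = (f'.comp f).comp (g.comp (e.comp f)) := by rw [h2, id_comp]
    _ = f'.comp (((f.comp g).comp e).comp f) := by simp only [comp_assoc]
    _ = DomRatMap.id S Y := by rw [h3, id_comp, h2]

theorem IsBirational.eq_id_of_comp_eq {f : DomRatMap S X Y} {g : DomRatMap S X X}
    (hf : f.IsBirational) (h : g.comp f = f) : g = DomRatMap.id S X := by
  obtain ⟨f', h1, h2⟩ := hf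
  rw [← comp_id g, ← h1, ← comp_assoc, h]

end DomRatMap

theorem IsEquivariant.comp {S X Y Z : Scheme.{u}} [X.Over S] [Y.Over S] [Z.Over S] [IsIntegral X]
    [IsIntegral Y] [IsIntegral Z] {G : Type v} [Group G] {ρ₁ : G →* Bir S X} {ρ₂ : G →* Bir S Y}
    {ρ₃ : G →* Bir S Z} {φ : DomRatMap S X Y} {ψ : DomRatMap S Y Z} (hφ : IsEquivariant ρ₁ ρ₂ φ)
    (hψ : IsEquivariant ρ₂ ρ₃ ψ) : IsEquivariant ρ₁ ρ₃ (φ.comp ψ) := fun g ↦ by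
  rw [← DomRatMap.comp_assoc, hφ g, DomRatMap.comp_assoc, hψ g, DomRatMap.comp_assoc]

end RatAct

end

theorem mainTheorem5 {k : Type u} [Field k] [IsAlgClosed k] [CharZero k]
    {G : Type v} [Group G] [Finite G] (n : ℕ) (hn : 1 ≤ n)
    (X : Scheme.{u}) [X.Over (Spec (.of k))] [IsIntegral X]
    [IsSeparated (X ↘ Spec (.of k))] [LocallyOfFiniteType (X ↘ Spec (.of k))]
    [QuasiCompact (X ↘ Spec (.of k))] (hX : topologicalKrullDim X = n)
    (ρ : G →* RatAct.Bir (Spec (.of k)) X) (hρ : Function.Injective ρ)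
    (hfix : RatAct.HasFixedPoint ρ) :
    ∃ τ : G →* Matrix.GeneralLinearGroup (Fin n) k, Function.Injective τ ∧
      RatAct.IsNontrivialBaseChange ρ ((RatAct.glToBir k n).comp τ) := by
  obtain ⟨Y, _, _, σ, ⟨_, -, α, hα, hαeq⟩, y, hy, hσ⟩ := hfix
  have hY : letI := RatAct.stalkAlgebra k Y (genericPoint Y)
      Algebra.trdeg k Y.functionField = n := by
    obtain ⟨d, hd, htr⟩ := RatAct.topologicalKrullDim_eq_trdeg (k := k) X
    obtain rfl : d = n := by
      rw [hX] at hd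
      exact_mod_cast hd.symm
    -- `α` and its inverse `β` give the two inequalities of transcendence degrees.
    obtain ⟨β, -⟩ := hα
    exact le_antisymm (htr ▸ RatAct.trdeg_functionField_le α)
      (htr ▸ RatAct.trdeg_functionField_le β)
  obtain ⟨τ, φ, hφ, hτ⟩ := RatAct.exists_equivariant_of_fixed_point hY σ y hy hσ
  have hψ := hαeq.comp hφ
  refine ⟨τ, (injective_iff_map_eq_one τ).mpr fun g hg ↦ ?_, ?_⟩
  · refine (injective_iff_map_eq_one ρ).mp hρ g (Units.ext (hα.eq_id_of_comp_eq ?_))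
    rw [hαeq g, MonoidHom.comp_apply, hτ g hg]
    exact α.comp_id
  -- A birational compression is followed by a non-birational equivariant self-map of `kⁿ`; `hn`
  -- supplies the coordinate whose norm defines it.
  · by_cases hbir : (α.comp φ).IsBirational
    · obtain ⟨χ, hχ, hχbir⟩ := RatAct.exists_isEquivariant_not_isBirational τ ⟨0, hn⟩
      exact ⟨_, hψ.comp hχ, fun h ↦ hχbir (hbir.of_comp_left h)⟩
    · exact ⟨_, hψ, hbir⟩
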